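/- Let $X$ be a random vector in $\mathbb{R}^p$, $T$ a binary treatment with values in $\{0,1\}$, and $Y(0),Y(1)$ real random variables (the potential outcomes). Assume ignorability, $Y(s)\perp T\mid X$ for $s=0,1$; common support, i.e. the laws of $X\mid(T=1)$ and $X\mid(T=0)$ have the same support; and (Assumption 2) that for $s=0,1$ the law of $X\mid (T=s)$ is multivariate normal, with positive definite covariance matrix $\Sigma^{(s)}$. For a random element $W$, the central subspace $\mathcal S_{W}$ of $W\mid X$ is the unique subspace of $\mathbb{R}^p$ of minimal dimension among those for which every basis matrix $\beta$ satisfies $W\perp X\mid \beta'X$; $\mathcal S_{W\mid (X,T=t)}$ is the same notion for the conditional law given $T=t$. Fix $t\in\{0,1\}$. Let $\beta_{Y(t)}$ and $\beta_T$ be basis matrices of $\mathcal S_{Y(t)}$ and $\mathcal S_T$, and let $M_{Y(t)}$ and $M_T$ be candidate matrices, i.e. real matrices with $p$ rows whose column spaces are $\mathcal S_{Y(t)\mid (X,T=t)}$ and $\mathcal S_T$ respectively. Let $A\subset\{1,\dots,p\}$, let $X_A$ be the subvector of $X$ indexed by $A$, and assume (Assumption 1): if $\beta_{Y(t)}'X\not\perp\beta_T'X\mid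 X_A$, then there is a measurable $h:\mathbb{R}\to\mathbb{R}$ with $E\{h^2(Y(t))\mid X\}<\infty$ and $E\{|h(Y(t))|\mid X_A\}<\infty$ almost surely such that $\mathrm{Cov}[E\{h(Y(t))\mid\beta_{Y(t)}'X\},E\{T\mid\beta_T'X\}\mid X_A]$ is not almost surely zero. Write $P(\Sigma,\beta)=\beta(\beta'\Sigma\beta)^{-1}\beta'\Sigma$ and let $I_A$ be the submatrix of the $p\times p$ identity matrix consisting of the columns indexed by $A$. Then $$M_{Y(t)}'\Sigma^{(s)}P(\Sigma^{(s)},I_A)M_T=M_{Y(t)}'\Sigma^{(s)}M_T\quad\text{for both } s=0,1$$ if and only if $Y(t)\perp T\mid X_A$, i.e. if and only if $A$ is a sufficient adjustment set for $Y(t)$. Moreover $A$ is a sufficient adjustment set for $Y(t)$ if and only if $f_t(A)=0$, where, with $\|\cdot\|$ the spectral norm, subscripts $A$ and $-A$ denoting the rows/columns indexed by $A$ and by its complement, $$f_t(A)=\sum_{s=0,1}\big\|M_{Y(t),-A}'\{\Sigma^{(s)}_{-A,-A}-\Sigma^{(s)}_{-A,A}(\Sigma^{(s)}_{A,A})^{-1}\Sigma^{(s)}_{A,-A}\}M_{T,-A}\big\|$$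 for nonempty $A$, and $f_t(\emptyset)=\sum_{s=0,1}\|M_{Y(t)}'\Sigma^{(s)}M_T\|$. -/

import Mathlib

open MeasureTheory ProbabilityTheory
open scoped Matrix

noncomputable section

namespace CausalAdjustment

/-- The subvector `X_A` of a random vector `X`. -/
def subvector {Ω : Type*} {p : ℕ} (X : Ω → Fin p → ℝ) (A : Finset (Fin p)) :
    Ω → {i // i ∈ A} → ℝ :=
  fun ω i => X ω i

theorem measurable_subvector {Ω : Type*} [MeasurableSpace Ω] {p : ℕ} {X : Ω → Fin p → ℝ}
    (hX : Measurable X) (A : Finset (Fin p)) : Measurable (subvector X A) :=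
  measurable_pi_lambda _ fun i => (measurable_pi_apply (i : Fin p)).comp hX

/-- The reduced predictor `β' X`. -/
def reduced {Ω : Type*} {p d : ℕ} (β : Matrix (Fin p) (Fin d) ℝ) (X : Ω → Fin p → ℝ) :
    Ω → Fin d → ℝ :=
  fun ω => βᵀ *ᵥ X ω

theorem measurable_reduced {Ω : Type*} [MeasurableSpace Ω] {p d : ℕ}
    (β : Matrix (Fin p) (Fin d) ℝ) {X : Ω → Fin p → ℝ} (hX : Measurable X) :
    Measurable (reduced β X) := by
  refine measurable_pi_lambda _ fun j => ?_
  simp only [reduced, Matrix.mulVec, dotProduct]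
  exact Finset.measurable_sum _ fun i _ =>
    ((measurable_pi_apply i).comp hX).const_mul _

/-- The column space of a matrix. -/
def colSpace {p d : ℕ} (M : Matrix (Fin p) (Fin d) ℝ) : Submodule ℝ (Fin p → ℝ) :=
  Submodule.span ℝ (Set.range M.col)

/-- `β` is a basis matrix of the subspace `S`: its columns form a basis of `S`. -/
def IsBasisMatrix {p d : ℕ} (β : Matrix (Fin p) (Fin d) ℝ) (S : Submodule ℝ (Fin p → ℝ)) : Prop :=
  LinearIndependent ℝ β.col ∧ colSpace β = S

/-- `S` is a sufficient dimension reduction subspace for `W | X` under `μ`: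
`W ⊥ X | β' X` for an arbitrary basis matrix `β` of `S`. -/
def IsReductionSubspace {Ω : Type*} [MeasurableSpace Ω] [StandardBorelSpace Ω]
    {𝓦 : Type*} [MeasurableSpace 𝓦] {p : ℕ} (μ : Measure Ω) [IsFiniteMeasure μ]
    (W : Ω → 𝓦) {X : Ω → Fin p → ℝ} (hX : Measurable X) (S : Submodule ℝ (Fin p → ℝ)) : Prop :=
  ∀ (d : ℕ) (β : Matrix (Fin p) (Fin d) ℝ), IsBasisMatrix β S →
    W ⟂ᵢ[reduced β X, measurable_reduced β hX; μ] X

/-- `S` is the central subspace of `W | X` under `μ`: the unique subspace of minimal dimension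
among the sufficient dimension reduction subspaces. -/
def IsCentralSubspace {Ω : Type*} [MeasurableSpace Ω] [StandardBorelSpace Ω]
    {𝓦 : Type*} [MeasurableSpace 𝓦] {p : ℕ} (μ : Measure Ω) [IsFiniteMeasure μ]
    (W : Ω → 𝓦) {X : Ω → Fin p → ℝ} (hX : Measurable X) (S : Submodule ℝ (Fin p → ℝ)) : Prop :=
  IsReductionSubspace μ W hX S ∧
    ∀ S' : Submodule ℝ (Fin p → ℝ), IsReductionSubspace μ W hX S' → S' ≠ S →
      Module.finrank ℝ S < Module.finrank ℝ S'

/-- The law of the sub-population `T = s`. -/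
abbrev group {Ω : Type*} [MeasurableSpace Ω] (μ : Measure Ω) (T : Ω → Fin 2) (s : Fin 2) :
    Measure Ω :=
  ProbabilityTheory.cond μ (T ⁻¹' {s})

/-- The covariance matrix `Σ⁽ˢ⁾` of `X | (T = s)`. -/
def groupCov {Ω : Type*} [MeasurableSpace Ω] {p : ℕ} (μ : Measure Ω) (X : Ω → Fin p → ℝ)
    (T : Ω → Fin 2) (s : Fin 2) : Matrix (Fin p) (Fin p) ℝ :=
  Matrix.of fun i j => cov[fun ω => X ω i, fun ω => X ω j; group μ T s]

/-- The conditional mean `E (f | Z)`, computed from the regular conditional distribution given `Z`;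
it agrees almost surely with the usual conditional expectation when `f` is integrable and only
needs `f` to be conditionally integrable. -/
def condMean {Ω : Type*} [MeasurableSpace Ω] [StandardBorelSpace Ω] {𝓩 : Type*}
    [MeasurableSpace 𝓩] (μ : Measure Ω) [IsFiniteMeasure μ] (Z : Ω → 𝓩) (f : Ω → ℝ) : Ω → ℝ :=
  fun ω => ∫ ω', f ω' ∂(condExpKernel μ (MeasurableSpace.comap Z inferInstance) ω)

/-- The conditional covariance `Cov (f, g | Z)`. -/
def condCov {Ω : Type*} [MeasurableSpace Ω] [StandardBorelSpace Ω] {𝓩 : Type*}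
    [MeasurableSpace 𝓩] (μ : Measure Ω) [IsFiniteMeasure μ] (Z : Ω → 𝓩) (f g : Ω → ℝ) : Ω → ℝ :=
  fun ω => cov[f, g; condExpKernel μ (MeasurableSpace.comap Z inferInstance) ω]

/-- `E (|f| | Z) < ∞` almost surely. -/
def CondIntegrable {Ω : Type*} [MeasurableSpace Ω] [StandardBorelSpace Ω] {𝓩 : Type*}
    [MeasurableSpace 𝓩] (μ : Measure Ω) [IsFiniteMeasure μ] (Z : Ω → 𝓩) (f : Ω → ℝ) : Prop :=
  ∀ᵐ ω ∂μ, Integrable f (condExpKernel μ (MeasurableSpace.comap Z inferInstance) ω)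

/-- The regularity condition at the index set `A`: if `β_W' X` and `β_T' X` are dependent given
`X_A`, then `Cov [E {h(W) | β_W' X}, E {T | β_T' X} | X_A]` is not degenerate at zero for some
`h` with finite `E {h²(W) | X}`. The requirement `E {|h(W)| | X_A} < ∞` makes that conditional
covariance well defined. -/
def RegularityCondition {Ω : Type*} [MeasurableSpace Ω] [StandardBorelSpace Ω] {p a b : ℕ}
    (μ : Measure Ω) [IsFiniteMeasure μ] (W : Ω → ℝ) (T : Ω → Fin 2) {X : Ω → Fin p → ℝ}
    (hX : Measurable X) (βW : Matrix (Fin p) (Fin a) ℝ) (βT : Matrix (Fin p) (Fin b) ℝ)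
    (A : Finset (Fin p)) : Prop :=
  ¬ (reduced βW X ⟂ᵢ[subvector X A, measurable_subvector hX A; μ] reduced βT X) →
    ∃ h : ℝ → ℝ, Measurable h ∧
      CondIntegrable μ X (fun ω => h (W ω) ^ 2) ∧
      CondIntegrable μ (subvector X A) (fun ω => h (W ω)) ∧
      ¬ (condCov μ (subvector X A)
          (condMean μ (reduced βW X) (fun ω => h (W ω)))
          (condMean μ (reduced βT X) (fun ω => ((T ω : ℕ) : ℝ))) =ᵐ[μ] 0)

/-- `A` is a sufficient adjustment set for the potential outcome `W`: `W ⊥ T | X_A`. -/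
def IsSufficientAdjustmentSet {Ω : Type*} [MeasurableSpace Ω] [StandardBorelSpace Ω] {p : ℕ}
    (μ : Measure Ω) [IsFiniteMeasure μ] (W : Ω → ℝ) (T : Ω → Fin 2) {X : Ω → Fin p → ℝ}
    (hX : Measurable X) (A : Finset (Fin p)) : Prop :=
  W ⟂ᵢ[subvector X A, measurable_subvector hX A; μ] T

/-- `I_A`: the columns of the identity matrix indexed by `A`. -/
def idCols {p : ℕ} (A : Finset (Fin p)) : Matrix (Fin p) {i // i ∈ A} ℝ :=
  (1 : Matrix (Fin p) (Fin p) ℝ).submatrix id Subtype.val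

/-- The projection matrix `P(S, β) = β (β' S β)⁻¹ β' S`. -/
def proj {p : ℕ} {ι : Type*} [Fintype ι] [DecidableEq ι] (S : Matrix (Fin p) (Fin p) ℝ)
    (β : Matrix (Fin p) ι ℝ) : Matrix (Fin p) (Fin p) ℝ :=
  β * (βᵀ * S * β)⁻¹ * βᵀ * S

/-- The identity `M_Y' Σ⁽ˢ⁾ P(Σ⁽ˢ⁾, I_A) M_T = M_Y' Σ⁽ˢ⁾ M_T` for both `s = 0, 1`. -/
def DualIdentity {p k l : ℕ} (Sig : Fin 2 → Matrix (Fin p) (Fin p) ℝ)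
    (MY : Matrix (Fin p) (Fin k) ℝ) (MT : Matrix (Fin p) (Fin l) ℝ) (A : Finset (Fin p)) : Prop :=
  ∀ s : Fin 2, MYᵀ * Sig s * proj (Sig s) (idCols A) * MT = MYᵀ * Sig s * MT

open scoped Matrix.Norms.L2Operator in
/-- The spectral norm of a real matrix. -/
def spectralNorm {m n : Type*} [Fintype m] [Fintype n] [DecidableEq n] (M : Matrix m n ℝ) : ℝ :=
  ‖M‖

/-- The Schur complement `S_{-A,-A} - S_{-A,A} (S_{A,A})⁻¹ S_{A,-A}`. -/
def schurCompl {p : ℕ} (S : Matrix (Fin p) (Fin p) ℝ) (A : Finset (Fin p)) :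
    Matrix {i // i ∉ A} {i // i ∉ A} ℝ :=
  let inA : {i // i ∈ A} → Fin p := Subtype.val
  let outA : {i // i ∉ A} → Fin p := Subtype.val
  S.submatrix outA outA - S.submatrix outA inA * (S.submatrix inA inA)⁻¹ * S.submatrix inA outA

/-- The criterion `f_t(A)`. -/
def criterion {p k l : ℕ} (Sig : Fin 2 → Matrix (Fin p) (Fin p) ℝ)
    (MY : Matrix (Fin p) (Fin k) ℝ) (MT : Matrix (Fin p) (Fin l) ℝ) (A : Finset (Fin p)) : ℝ :=
  if A = ∅ then ∑ s : Fin 2, spectralNorm (MYᵀ * Sig s * MT)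
  else ∑ s : Fin 2, spectralNorm
    ((MY.submatrix (Subtype.val : {i // i ∉ A} → Fin p) id)ᵀ * schurCompl (Sig s) A *
      MT.submatrix (Subtype.val : {i // i ∉ A} → Fin p) id)

end CausalAdjustment

end

noncomputable section

namespace CausalAdjustment

/-! ### Linear algebra of the dual identity -/

/-! Write `U = βY'X`, `V = βT'X`, `Z = X_A`. Both sides of the equivalence reduce to `U ⟂ V | Z`.

Sufficiency: `Y(t)` and `T` depend on `X` only through `U` and `V`, so ignorability and the tower
property give `E{h(Y(t)) j(T) | Z} = E[E{h(Y(t)) | U} E{j(T) | V} | Z]` (`ae_integral_condMean`).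
With indicators, `U ⟂ V | Z` yields `Y(t) ⟂ T | Z`. Conversely, if `Y(t) ⟂ T | Z`, then the
conditional covariance of the two regressions vanishes for every admissible `h`, and the regularity
condition forces `U ⟂ V | Z`.

Normality holds only inside the groups. Since `T ⟂ X | V`, the law of `X` in group `s` is its
overall law reweighted by a function of `V`. Such a reweighting preserves `U ⟂ V | Z`, and it can be
undone because the nondegenerate Gaussian group laws are equivalent to Lebesgue measure
(`condIndepFun_group_iff`). Inside a group, the residual of `X` after regression on `X_A` is
independent of `X_A`, so `U ⟂ V | Z` says that the residuals of `U` and `V` are uncorrelated: `βY'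
(Σ - Σ P(Σ, I_A)) βT = 0` (`HasGaussianLaw.condIndepFun_reduced_iff`).

Reweighting by a function of `X`, allowed by ignorability, also identifies the central subspaces of
`Y(t)` overall and in group `t`, so candidate matrices may replace basis matrices. Finally, `Σ - Σ
P(Σ, I_A)` is the Schur complement bordered by zeros, which gives the criterion. -/

/-- The residual form `S - S P(S, I_A)`. -/
def residualForm {p : ℕ} (S : Matrix (Fin p) (Fin p) ℝ) (A : Finset (Fin p)) :
    Matrix (Fin p) (Fin p) ℝ :=
  S - S * proj S (idCols A)

theorem dualIdentity_iff_residualForm {p k l : ℕ} (Sig : Fin 2 → Matrix (Fin p) (Fin p) ℝ)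
    (MY : Matrix (Fin p) (Fin k) ℝ) (MT : Matrix (Fin p) (Fin l) ℝ) (A : Finset (Fin p)) :
    DualIdentity Sig MY MT A ↔ ∀ s, MYᵀ * residualForm (Sig s) A * MT = 0 := by
  refine forall_congr' fun s => ?_
  rw [residualForm, Matrix.mul_sub, Matrix.sub_mul, sub_eq_zero, ← Matrix.mul_assoc, eq_comm]

theorem colSpace_eq_range_mulVecLin {p d : ℕ} (M : Matrix (Fin p) (Fin d) ℝ) :
    colSpace M = LinearMap.range M.mulVecLin :=
  (Matrix.range_mulVecLin M).symm

theorem exists_mul_of_colSpace_le {p d e : ℕ} {M : Matrix (Fin p) (Fin d) ℝ}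
    {N : Matrix (Fin p) (Fin e) ℝ} (h : colSpace M ≤ colSpace N) :
    ∃ C : Matrix (Fin e) (Fin d) ℝ, M = N * C := by
  have hc : ∀ j, ∃ c : Fin e → ℝ, N *ᵥ c = M.col j := fun j => by
    have : M.col j ∈ colSpace N := h (Submodule.subset_span ⟨j, rfl⟩)
    rw [colSpace_eq_range_mulVecLin] at this
    simpa using this
  choose c hc using hc
  refine ⟨Matrix.of fun i j => c j i, ?_⟩
  ext i j
  have := congrFun (hc j) i
  simpa [Matrix.mulVec, dotProduct, Matrix.mul_apply] using this.symm

theorem transpose_mul_mul_eq_zero_of_colSpace_le {p k l k' l' : ℕ}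
    {K : Matrix (Fin p) (Fin p) ℝ}
    {MY : Matrix (Fin p) (Fin k) ℝ} {MT : Matrix (Fin p) (Fin l) ℝ}
    {NY : Matrix (Fin p) (Fin k') ℝ} {NT : Matrix (Fin p) (Fin l') ℝ}
    (hY : colSpace NY ≤ colSpace MY) (hT : colSpace NT ≤ colSpace MT)
    (h : MYᵀ * K * MT = 0) : NYᵀ * K * NT = 0 := by
  obtain ⟨C, rfl⟩ := exists_mul_of_colSpace_le hY
  obtain ⟨D, rfl⟩ := exists_mul_of_colSpace_le hT
  calc (MY * C)ᵀ * K * (MT * D) = Cᵀ * (MYᵀ * K * MT) * D := by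
        simp only [Matrix.transpose_mul, Matrix.mul_assoc]
    _ = 0 := by rw [h]; simp

theorem transpose_idCols_mul {p : ℕ} (A : Finset (Fin p)) {ι : Type*}
    (M : Matrix (Fin p) ι ℝ) : (idCols A)ᵀ * M = M.submatrix Subtype.val id := by
  ext i j
  simp [idCols, Matrix.mul_apply, Matrix.one_apply]

theorem mul_idCols {p : ℕ} (A : Finset (Fin p)) {ι : Type*}
    (M : Matrix ι (Fin p) ℝ) : M * idCols A = M.submatrix id Subtype.val := by
  ext i j
  simp [idCols, Matrix.mul_apply, Matrix.one_apply]

theorem transpose_idCols_mulVec {p : ℕ} (A : Finset (Fin p)) (v : Fin p → ℝ) :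
    (idCols A)ᵀ *ᵥ v = fun i : {i // i ∈ A} => v i := by
  ext i
  simp [idCols, Matrix.mulVec, dotProduct, Matrix.one_apply]

theorem gram_idCols {p : ℕ} (S : Matrix (Fin p) (Fin p) ℝ) (A : Finset (Fin p)) :
    (idCols A)ᵀ * S * idCols A = S.submatrix Subtype.val Subtype.val := by
  rw [transpose_idCols_mul, mul_idCols]
  rfl

theorem isUnit_det_gram_idCols {p : ℕ} {S : Matrix (Fin p) (Fin p) ℝ} (hS : S.PosDef)
    (A : Finset (Fin p)) : IsUnit ((idCols A)ᵀ * S * idCols A).det := by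
  rw [gram_idCols]
  exact (hS.submatrix Subtype.val_injective).det_pos.ne'.isUnit

/-- `P(S, I_A)` fixes the columns of `I_A`; positive definiteness serves only to invert `S_{A,A}`.
-/
theorem residualForm_mul_idCols {p : ℕ} {S : Matrix (Fin p) (Fin p) ℝ} (hS : S.PosDef)
    (A : Finset (Fin p)) : residualForm S A * idCols A = 0 := by
  rw [residualForm, proj, Matrix.sub_mul, sub_eq_zero]
  calc S * idCols A
      = S * (idCols A * (((idCols A)ᵀ * S * idCols A)⁻¹ * ((idCols A)ᵀ * S * idCols A))) := by
        rw [Matrix.nonsing_inv_mul _ (isUnit_det_gram_idCols hS A), Matrix.mul_one]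
    _ = _ := by simp only [Matrix.mul_assoc]

theorem transpose_idCols_mul_residualForm {p : ℕ} {S : Matrix (Fin p) (Fin p) ℝ} (hS : S.PosDef)
    (A : Finset (Fin p)) : (idCols A)ᵀ * residualForm S A = 0 := by
  rw [residualForm, proj, Matrix.mul_sub, sub_eq_zero]
  calc (idCols A)ᵀ * S
      = (((idCols A)ᵀ * S * idCols A) * ((idCols A)ᵀ * S * idCols A)⁻¹) * ((idCols A)ᵀ * S) := by
        rw [Matrix.mul_nonsing_inv _ (isUnit_det_gram_idCols hS A), Matrix.one_mul]
    _ = _ := by simp only [Matrix.mul_assoc]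

theorem residualForm_apply_right_mem {p : ℕ} {S : Matrix (Fin p) (Fin p) ℝ} (hS : S.PosDef)
    {A : Finset (Fin p)} (i : Fin p) {j : Fin p} (hj : j ∈ A) : residualForm S A i j = 0 := by
  have := congrFun (congrFun (residualForm_mul_idCols hS A) i) ⟨j, hj⟩
  rwa [mul_idCols] at this

theorem residualForm_apply_left_mem {p : ℕ} {S : Matrix (Fin p) (Fin p) ℝ} (hS : S.PosDef)
    {A : Finset (Fin p)} {i : Fin p} (hi : i ∈ A) (j : Fin p) : residualForm S A i j = 0 := by
  have := congrFun (congrFun (transpose_idCols_mul_residualForm hS A) ⟨i, hi⟩) j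
  rwa [transpose_idCols_mul] at this

theorem residualForm_submatrix_compl {p : ℕ} (S : Matrix (Fin p) (Fin p) ℝ)
    (A : Finset (Fin p)) :
    (residualForm S A).submatrix (Subtype.val : {i // i ∉ A} → Fin p) Subtype.val =
      schurCompl S A := by
  have h : residualForm S A = S - S * idCols A * ((idCols A)ᵀ * S * idCols A)⁻¹ *
      ((idCols A)ᵀ * S) := by
    rw [residualForm, proj]
    simp only [Matrix.mul_assoc]
  rw [h, gram_idCols, mul_idCols, transpose_idCols_mul]
  rfl

/-- The rows and columns of the residual form indexed by `A` vanish, so only its complementary block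
contributes. -/
theorem transpose_mul_residualForm_mul {p k l : ℕ} {S : Matrix (Fin p) (Fin p) ℝ}
    (hS : S.PosDef) (MY : Matrix (Fin p) (Fin k) ℝ) (MT : Matrix (Fin p) (Fin l) ℝ)
    (A : Finset (Fin p)) :
    (MY.submatrix (Subtype.val : {i // i ∉ A} → Fin p) id)ᵀ * schurCompl S A *
      MT.submatrix (Subtype.val : {i // i ∉ A} → Fin p) id = MYᵀ * residualForm S A * MT := by
  have key : ∀ f : Fin p → ℝ, (∀ i ∈ A, f i = 0) → ∑ i : {i // i ∉ A}, f i = ∑ i, f i := by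
    intro f hf
    rw [← Fintype.sum_subtype_add_sum_subtype (fun i => i ∈ A) f]
    refine (zero_add _).symm.trans ?_
    congr 1
    exact (Finset.sum_eq_zero fun (i : {i // i ∈ A}) _ => hf i i.2).symm
  rw [← residualForm_submatrix_compl]
  ext a b
  simp only [Matrix.mul_apply, Matrix.transpose_apply, Matrix.submatrix_apply, id]
  rw [← key]
  · refine Finset.sum_congr rfl fun j _ => ?_
    congr 1
    exact key (fun i => MY i a * residualForm S A i j) fun i hi => by
      rw [residualForm_apply_left_mem hS hi, mul_zero]
  · intro j hj
    simp [residualForm_apply_right_mem hS _ hj]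

theorem residualForm_empty {p : ℕ} (S : Matrix (Fin p) (Fin p) ℝ) : residualForm S ∅ = S := by
  have : proj S (idCols (∅ : Finset (Fin p))) = 0 := by
    ext i j
    simp [proj, Matrix.mul_assoc, Matrix.mul_apply]
  rw [residualForm, this, Matrix.mul_zero, sub_zero]

theorem spectralNorm_eq_zero_iff {m n : Type*} [Fintype m] [Fintype n] [DecidableEq n]
    (M : Matrix m n ℝ) : spectralNorm M = 0 ↔ M = 0 := by
  open scoped Matrix.Norms.L2Operator in exact norm_eq_zero

theorem spectralNorm_nonneg {m n : Type*} [Fintype m] [Fintype n] [DecidableEq n]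
    (M : Matrix m n ℝ) : 0 ≤ spectralNorm M := by
  open scoped Matrix.Norms.L2Operator in exact norm_nonneg M

theorem criterion_eq {p k l : ℕ} {Sig : Fin 2 → Matrix (Fin p) (Fin p) ℝ}
    (hSig : ∀ s, (Sig s).PosDef) (MY : Matrix (Fin p) (Fin k) ℝ) (MT : Matrix (Fin p) (Fin l) ℝ)
    (A : Finset (Fin p)) :
    criterion Sig MY MT A = ∑ s, spectralNorm (MYᵀ * residualForm (Sig s) A * MT) := by
  unfold criterion
  split_ifs with hA
  · subst hA
    simp only [residualForm_empty]
  · exact Finset.sum_congr rfl fun s _ => by rw [transpose_mul_residualForm_mul (hSig s)]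

theorem criterion_eq_zero_iff {p k l : ℕ} {Sig : Fin 2 → Matrix (Fin p) (Fin p) ℝ}
    (hSig : ∀ s, (Sig s).PosDef) (MY : Matrix (Fin p) (Fin k) ℝ) (MT : Matrix (Fin p) (Fin l) ℝ)
    (A : Finset (Fin p)) : criterion Sig MY MT A = 0 ↔ DualIdentity Sig MY MT A := by
  rw [criterion_eq hSig, dualIdentity_iff_residualForm,
    Finset.sum_eq_zero_iff_of_nonneg fun _ _ => spectralNorm_nonneg _]
  simp [spectralNorm_eq_zero_iff]

/-! ### Conditional independence and change of measure -/

section ChangeOfMeasure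

variable {Ω : Type*} [MeasurableSpace Ω] [StandardBorelSpace Ω]
  {𝓖 : Type*} [MeasurableSpace 𝓖] [StandardBorelSpace 𝓖] [Nonempty 𝓖]
  {𝓕 : Type*} [MeasurableSpace 𝓕] [StandardBorelSpace 𝓕] [Nonempty 𝓕]
  {𝓚 : Type*} [MeasurableSpace 𝓚]

/-- Conditional independence in terms of the joint law only. -/
theorem condIndepFun_iff_exists_kernel {μ : Measure Ω} [IsFiniteMeasure μ]
    {g : Ω → 𝓖} (hg : Measurable g) {f : Ω → 𝓕} (hf : Measurable f) {k : Ω → 𝓚}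
    (hk : Measurable k) :
    g ⟂ᵢ[k, hk; μ] f ↔ ∃ κ : Kernel 𝓚 𝓕, IsMarkovKernel κ ∧
      μ.map (fun ω => ((k ω, g ω), f ω)) = μ.map (fun ω => (k ω, g ω)) ⊗ₘ κ.prodMkRight 𝓖 := by
  rw [condIndepFun_iff_condDistrib_prod_ae_eq_prodMkRight hf hg hk]
  constructor
  · intro h
    exact ⟨condDistrib f k μ, inferInstance,
      (condDistrib_ae_eq_iff_measure_eq_compProd _ hf.aemeasurable _).1 h⟩
  · rintro ⟨κ, hκ, h⟩
    -- Integrating out `g` shows that `κ` must be a version of the conditional law of `f` given `k`.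
    have hmarg : μ.map (fun ω => (k ω, f ω)) = μ.map k ⊗ₘ κ := by
      refine Measure.ext_prod fun {s t} hs ht => ?_
      have h' := congrArg (fun m => m ((s ×ˢ Set.univ) ×ˢ t)) h
      rw [Measure.map_apply (by fun_prop) ((hs.prod .univ).prod ht),
        Measure.compProd_apply_prod (hs.prod .univ) ht,
        setLIntegral_map (hs.prod .univ) (Kernel.measurable_coe _ ht) (by fun_prop)] at h'
      rw [Measure.map_apply (by fun_prop) (hs.prod ht), Measure.compProd_apply_prod hs ht,
        setLIntegral_map hs (Kernel.measurable_coe _ ht) hk]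
      simpa [Set.mk_preimage_prod] using h'
    have h1 := (condDistrib_ae_eq_iff_measure_eq_compProd k hf.aemeasurable κ).2 hmarg
    have h2 := (condDistrib_ae_eq_iff_measure_eq_compProd (μ := μ) (fun ω => (k ω, g ω))
      hf.aemeasurable (κ.prodMkRight 𝓖)).2 h
    have h3 : ∀ᵐ x ∂μ.map (fun ω => (k ω, g ω)), condDistrib f k μ x.1 = κ x.1 := by
      refine ae_of_ae_map (f := Prod.fst) (p := fun c => condDistrib f k μ c = κ c)
        measurable_fst.aemeasurable ?_
      rwa [Measure.map_map measurable_fst (by fun_prop)]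
    filter_upwards [h2, h3] with x hx hx'
    rw [hx, Kernel.prodMkRight_apply, Kernel.prodMkRight_apply, hx']

theorem condIndepFun_map_iff {Ω' : Type*} [MeasurableSpace Ω'] [StandardBorelSpace Ω']
    {μ : Measure Ω} [IsFiniteMeasure μ] {r : Ω → Ω'} (hr : Measurable r)
    {g : Ω' → 𝓖} (hg : Measurable g) {f : Ω' → 𝓕} (hf : Measurable f) {k : Ω' → 𝓚}
    (hk : Measurable k) :
    (fun ω => g (r ω)) ⟂ᵢ[fun ω => k (r ω), hk.comp hr; μ] (fun ω => f (r ω)) ↔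
      g ⟂ᵢ[k, hk; μ.map r] f := by
  refine (condIndepFun_iff_exists_kernel (hg.comp hr) (hf.comp hr) (hk.comp hr)).trans ?_
  rw [condIndepFun_iff_exists_kernel hg hf hk, Measure.map_map (by fun_prop) hr,
    Measure.map_map (by fun_prop) hr]
  rfl

theorem withDensity_comp_map {α β : Type*} [MeasurableSpace α] [MeasurableSpace β]
    (μ : Measure α) {φ : α → β} (hφ : Measurable φ) {w : β → ENNReal} (hw : Measurable w) :
    (μ.withDensity fun x => w (φ x)).map φ = (μ.map φ).withDensity w := by
  ext s hs
  rw [Measure.map_apply hφ hs, withDensity_apply _ (hφ hs), withDensity_apply _ hs,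
    setLIntegral_map hs hw hφ]

theorem compProd_withDensity_fst {α β : Type*} [MeasurableSpace α] [MeasurableSpace β]
    (ν : Measure α) [SFinite ν] (κ : Kernel α β) [IsSFiniteKernel κ] {w : α → ENNReal}
    (hw : Measurable w) :
    (ν ⊗ₘ κ).withDensity (fun x => w x.1) = ν.withDensity w ⊗ₘ κ := by
  refine Measure.ext fun s hs => ?_
  have hm : Measurable fun x : α × β => w x.1 := hw.comp measurable_fst
  rw [withDensity_apply _ hs, Measure.compProd_apply hs, ← lintegral_indicator hs,
    Measure.lintegral_compProd (hm.indicator hs),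
    lintegral_withDensity_eq_lintegral_mul _ hw (Kernel.measurable_kernel_prodMk_left hs)]
  refine lintegral_congr fun a => ?_
  have hsa : MeasurableSet (Prod.mk a ⁻¹' s) := measurable_prodMk_left hs
  rw [Pi.mul_apply, ← lintegral_indicator_const hsa]
  rfl

/-- Conditional independence of `g` and `f` given `k` is preserved when the measure is reweighted
by a function of `g`. -/
theorem CondIndepFun.withDensity_comp {ρ ρ' : Measure Ω} [IsFiniteMeasure ρ] [IsFiniteMeasure ρ']
    {g : Ω → 𝓖} (hg : Measurable g) {f : Ω → 𝓕} (hf : Measurable f) {k : Ω → 𝓚}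
    (hk : Measurable k) {w : 𝓖 → ENNReal} (hw : Measurable w)
    (hρ : ρ' = ρ.withDensity fun x => w (g x)) (h : g ⟂ᵢ[k, hk; ρ] f) : g ⟂ᵢ[k, hk; ρ'] f := by
  rw [condIndepFun_iff_exists_kernel hg hf hk] at h ⊢
  obtain ⟨κ, hκ, h⟩ := h
  -- The same kernel works: the weight is a function of `(k, g)` and leaves the conditional law of
  -- `f` untouched.
  refine ⟨κ, hκ, ?_⟩
  have e1 := withDensity_comp_map ρ (φ := fun ω => ((k ω, g ω), f ω)) (by fun_prop)
    (w := fun x => w x.1.2) (by fun_prop)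
  have e2 := withDensity_comp_map ρ (φ := fun ω => (k ω, g ω)) (by fun_prop)
    (w := fun x => w x.2) (by fun_prop)
  rw [hρ, e1, e2, h]
  exact compProd_withDensity_fst _ _ (w := fun x : 𝓚 × 𝓖 => w x.2) (by fun_prop)

/-- The converse reweights by `w⁻¹`: absolute continuity makes `w (g x)` nonzero almost everywhere,
and finiteness of `ρ'` makes it finite. -/
theorem condIndepFun_withDensity_comp_iff {ρ ρ' : Measure Ω} [IsFiniteMeasure ρ]
    [IsFiniteMeasure ρ'] {g : Ω → 𝓖} (hg : Measurable g) {f : Ω → 𝓕} (hf : Measurable f)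
    {k : Ω → 𝓚} (hk : Measurable k) {w : 𝓖 → ENNReal} (hw : Measurable w)
    (hρ : ρ' = ρ.withDensity fun x => w (g x)) (hac : ρ.map g ≪ ρ'.map g) :
    g ⟂ᵢ[k, hk; ρ] f ↔ g ⟂ᵢ[k, hk; ρ'] f := by
  refine ⟨CondIndepFun.withDensity_comp hg hf hk hw hρ, ?_⟩
  have hmap : ρ'.map g = (ρ.map g).withDensity w := by rw [hρ, withDensity_comp_map ρ hg hw]
  have hwg : Measurable fun x => w (g x) := hw.comp hg
  refine CondIndepFun.withDensity_comp hg hf hk hw.inv ?_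
  have h0 : ∀ᵐ x ∂ρ, w (g x) ≠ 0 := by
    refine ae_of_ae_map hg.aemeasurable (p := fun y => w y ≠ 0) ?_
    refine hac ?_
    rw [hmap, withDensity_apply_eq_zero hw]
    convert measure_empty (μ := ρ.map g)
    ext y; simp
  have htop : ∀ᵐ x ∂ρ, w (g x) ≠ ⊤ := by
    have : ∫⁻ x, w (g x) ∂ρ ≠ ⊤ := by
      rw [← setLIntegral_univ, ← withDensity_apply _ MeasurableSet.univ, ← hρ]
      exact measure_ne_top _ _
    exact (ae_lt_top hwg this).mono fun _ h => h.ne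
  rw [hρ]
  exact (withDensity_inv_same hwg h0 htop).symm

/-- The law of `(V, W)` in the group `T = s` has a density depending only on `V` with respect to
its overall law as soon as `T` is conditionally independent of `W` given `V`. -/
theorem exists_map_group_eq_withDensity {μ : Measure Ω} [IsFiniteMeasure μ] {T : Ω → Fin 2}
    (hT : Measurable T) (s : Fin 2) {V : Ω → 𝓚} (hV : Measurable V) {W : Ω → 𝓖}
    (hW : Measurable W) (h : W ⟂ᵢ[V, hV; μ] T) :
    ∃ w : 𝓚 → ENNReal, Measurable w ∧
      (group μ T s).map (fun ω => (V ω, W ω)) =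
        (μ.map fun ω => (V ω, W ω)).withDensity fun x => w x.1 := by
  obtain ⟨κ, hκ, h⟩ := (condIndepFun_iff_exists_kernel hW hT hV).1 h
  have hκs : Measurable fun v => κ v {s} := Kernel.measurable_coe _ (measurableSet_singleton s)
  -- Bayes' rule: the density is `P(T = s | V = v) / P(T = s)`.
  refine ⟨fun v => (μ (T ⁻¹' {s}))⁻¹ * κ v {s}, hκs.const_mul _, ?_⟩
  have hVW : Measurable fun ω => (V ω, W ω) := hV.prodMk hW
  ext D hD
  have h' := congrArg (fun m => m (D ×ˢ {s})) h
  rw [Measure.map_apply (by fun_prop) (hD.prod (measurableSet_singleton s)),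
    Measure.compProd_apply_prod hD (measurableSet_singleton s)] at h'
  rw [Measure.map_apply hVW hD, group, cond_apply (hT (measurableSet_singleton s)),
    withDensity_apply _ hD, lintegral_const_mul _ (by fun_prop)]
  congr 1
  rw [Set.inter_comm]
  exact h'

/-- On the joint law of `(V, W)`, restriction to a group is a reweighting by a function of `V`, one
of the two variables being compared. It is used with `V = X`, `W = Y(t)` and with `V = βT'X`, `W =
X`. -/
theorem condIndepFun_group_iff {𝓥 𝓦 : Type*} [MeasurableSpace 𝓥] [StandardBorelSpace 𝓥]
    [Nonempty 𝓥] [MeasurableSpace 𝓦] [StandardBorelSpace 𝓦] [Nonempty 𝓦]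
    {μ : Measure Ω} [IsFiniteMeasure μ] {T : Ω → Fin 2}
    (hT : Measurable T) (s : Fin 2) {V : Ω → 𝓥} (hV : Measurable V) {W : Ω → 𝓦}
    (hW : Measurable W) (h : W ⟂ᵢ[V, hV; μ] T) (hac : μ.map V ≪ (group μ T s).map V)
    {f : 𝓥 × 𝓦 → 𝓕} (hf : Measurable f) {k : 𝓥 × 𝓦 → 𝓚} (hk : Measurable k) :
    V ⟂ᵢ[fun ω => k (V ω, W ω), hk.comp (hV.prodMk hW); μ] (fun ω => f (V ω, W ω)) ↔
      V ⟂ᵢ[fun ω => k (V ω, W ω), hk.comp (hV.prodMk hW); group μ T s]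
        (fun ω => f (V ω, W ω)) := by
  obtain ⟨w, hw, hρ⟩ := exists_map_group_eq_withDensity hT s hV hW h
  have hVW : Measurable fun ω => (V ω, W ω) := hV.prodMk hW
  have h1 := condIndepFun_map_iff (μ := μ) hVW measurable_fst hf hk
  have h2 := condIndepFun_map_iff (μ := group μ T s) hVW measurable_fst hf hk
  refine h1.trans (Iff.trans ?_ h2.symm)
  refine condIndepFun_withDensity_comp_iff measurable_fst hf hk hw hρ ?_
  rw [Measure.map_map measurable_fst hVW, Measure.map_map measurable_fst hVW]
  exact hac

end ChangeOfMeasure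

/-! ### Iterated conditioning through regular conditional distributions -/

/-- A countable generating algebra of sets yields one null set valid for all `s`. -/
theorem ae_eq_measure_of_forall_measurableSet {α β : Type*} {mα : MeasurableSpace α}
    {mβ : MeasurableSpace β} [MeasurableSpace.CountablyGenerated β] {μ : Measure α}
    {P Q : α → Measure β} [∀ a, IsProbabilityMeasure (P a)] [∀ a, IsProbabilityMeasure (Q a)]
    (h : ∀ s, MeasurableSet s → ∀ᵐ a ∂μ, P a s = Q a s) : ∀ᵐ a ∂μ, P a = Q a := by
  let C := generateSetAlgebra (MeasurableSpace.countableGeneratingSet β)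
  have hC : C.Countable :=
    countable_generateSetAlgebra (MeasurableSpace.countable_countableGeneratingSet (α := β))
  have hgen : mβ = MeasurableSpace.generateFrom C := by
    rw [generateFrom_generateSetAlgebra_eq,
      MeasurableSpace.generateFrom_countableGeneratingSet]
  have hall : ∀ᵐ a ∂μ, ∀ s ∈ C, P a s = Q a s := by
    refine (ae_ball_iff hC).2 fun s hs => h s ?_
    rw [hgen]
    exact MeasurableSpace.measurableSet_generateFrom hs
  filter_upwards [hall] with a ha
  exact ext_of_generate_finite C hgen
    isSetAlgebra_generateSetAlgebra.isSetRing.isSetSemiring.isPiSystem ha (by simp)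

theorem integrable_integral_of_integrable_comp {α β : Type*} {mα : MeasurableSpace α}
    {mβ : MeasurableSpace β} {ν : Measure α} [SFinite ν] {κ : Kernel α β} [IsSFiniteKernel κ]
    {f : β → ℝ} (hf : Integrable f (κ ∘ₘ ν)) : Integrable (fun x => ∫ y, f y ∂κ x) ν := by
  rw [Measure.comp_eq_comp_const_apply] at hf
  exact hf.integral_comp

theorem integral_measure_comp {α β : Type*} {mα : MeasurableSpace α}
    {mβ : MeasurableSpace β} {ν : Measure α} [SFinite ν] {κ : Kernel α β} [IsSFiniteKernel κ]
    {f : β → ℝ} (hf : Integrable f (κ ∘ₘ ν)) :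
    ∫ y, f y ∂(κ ∘ₘ ν) = ∫ x, ∫ y, f y ∂κ x ∂ν := by
  rw [Measure.comp_eq_comp_const_apply] at hf ⊢
  rw [Kernel.integral_comp hf]
  rfl

section IteratedConditioning

variable {Ω : Type*} {m m' mΩ : MeasurableSpace Ω} [StandardBorelSpace Ω]

/-- The conditional expectation kernel as a kernel on the full sigma-algebra. -/
def fullCondExpKernel (μ : Measure Ω) [IsFiniteMeasure μ] (hm : m ≤ mΩ) :
    Kernel Ω Ω :=
  (condExpKernel μ m).comap id (measurable_id'' hm)

instance (μ : Measure Ω) [IsFiniteMeasure μ] (hm : m ≤ mΩ) :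
    IsMarkovKernel (fullCondExpKernel μ hm) := by
  unfold fullCondExpKernel; infer_instance

theorem fullCondExpKernel_comp (μ : Measure Ω) [IsFiniteMeasure μ]
    (hm : m ≤ mΩ) : fullCondExpKernel μ hm ∘ₘ μ = μ := by
  ext s hs
  rw [Measure.bind_apply hs (fullCondExpKernel μ hm).aemeasurable]
  have h := congrArg (fun ν => ν s) (condExpKernel_comp_trim (μ := μ) hm)
  rw [Measure.bind_apply hs (Kernel.aemeasurable _),
    lintegral_trim hm ((condExpKernel μ m).measurable_coe hs)] at h
  exact h

/-- This is the tower property of conditional expectation, applied to each event and then made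
uniform over events. -/
theorem ae_fullCondExpKernel_comp_condExpKernel (μ : Measure Ω) [IsFiniteMeasure μ]
    (hmm' : m ≤ m') (hm' : m' ≤ mΩ) :
    ∀ᵐ ω ∂μ, fullCondExpKernel μ hm' ∘ₘ (condExpKernel μ m ω) = condExpKernel μ m ω := by
  have hm := hmm'.trans hm'
  have : ∀ ω, IsProbabilityMeasure (fullCondExpKernel μ hm' ∘ₘ (condExpKernel μ m ω)) :=
    fun ω => inferInstance
  have : ∀ ω, IsProbabilityMeasure (condExpKernel μ m ω) := fun ω => inferInstance
  refine ae_eq_measure_of_forall_measurableSet fun s hs => ?_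
  have hint : Integrable (fun ω => (condExpKernel μ m' ω).real s) μ :=
    integrable_toReal_condExpKernel hs
  have h1 := condExp_ae_eq_integral_condExpKernel hm hint
  have h2 : μ[fun ω => (condExpKernel μ m' ω).real s | m] =ᵐ[μ] μ[μ⟦s | m'⟧ | m] :=
    condExp_congr_ae (condExpKernel_ae_eq_condExp hm' hs)
  have h3 : μ[μ⟦s | m'⟧ | m] =ᵐ[μ] μ⟦s | m⟧ := condExp_condExp_of_le hmm' hm'
  have h4 := condExpKernel_ae_eq_condExp (μ := μ) hm hs
  filter_upwards [h1, h2, h3, h4] with ω h1 h2 h3 h4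
  rw [← ENNReal.toReal_eq_toReal_iff' (measure_ne_top _ _) (measure_ne_top _ _)]
  rw [Measure.bind_apply hs (Kernel.aemeasurable _), ← integral_toReal]
  · exact (h1.symm.trans (h2.trans h3)).trans h4.symm
  · exact (Kernel.measurable_coe _ hs).aemeasurable
  · exact Filter.Eventually.of_forall fun _ => measure_lt_top _ _

theorem ae_ae_condExpKernel_of_ae {μ : Measure Ω} [IsFiniteMeasure μ]
    (hm : m ≤ mΩ) {q : Ω → Prop} (h : ∀ᵐ ω ∂μ, q ω) :
    ∀ᵐ ω ∂μ, ∀ᵐ ω' ∂(condExpKernel μ m ω), q ω' := by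
  have : ∀ᵐ ω ∂μ, ∀ᵐ ω' ∂(fullCondExpKernel μ hm ω), q ω' := by
    refine Measure.ae_ae_of_ae_comp ?_
    rwa [fullCondExpKernel_comp]
  exact this

section Independence

variable {β γ 𝓩 : Type*} {mβ : MeasurableSpace β} {mγ : MeasurableSpace γ}
  {m𝓩 : MeasurableSpace 𝓩} {μ : Measure Ω} [IsFiniteMeasure μ]

theorem CondIndepFun.ae_indepFun [MeasurableSpace.CountablyGenerated β]
    [MeasurableSpace.CountablyGenerated γ] {f : Ω → β} {g : Ω → γ} {Z : Ω → 𝓩}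
    (hf : Measurable f) (hg : Measurable g) (hZ : Measurable Z) (h : f ⟂ᵢ[Z, hZ; μ] g) :
    ∀ᵐ ω ∂μ, IndepFun f g (condExpKernel μ (m𝓩.comap Z) ω) := by
  have h := ae_of_ae_trim hZ.comap_le ((condIndepFun_iff_map_prod_eq_prod_map_map hf hg).1 h)
  filter_upwards [h] with ω hω
  rw [indepFun_iff_map_prod_eq_prod_map_map hf.aemeasurable hg.aemeasurable]
  rwa [Kernel.map_apply _ (hf.prodMk hg), Kernel.prod_apply, Kernel.map_apply _ hf,
    Kernel.map_apply _ hg] at hω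

/-- If `W` is conditionally independent of `X` given the function `U` of `X`, then the conditional
laws of `W` given `U` and given `X` agree. -/
theorem CondIndepFun.ae_map_condExpKernel_eq {𝓧 𝓤 𝓦 : Type*} {m𝓧 : MeasurableSpace 𝓧}
    [StandardBorelSpace 𝓧] [Nonempty 𝓧] {m𝓤 : MeasurableSpace 𝓤} {m𝓦 : MeasurableSpace 𝓦}
    [StandardBorelSpace 𝓦] [Nonempty 𝓦] {X : Ω → 𝓧} (hX : Measurable X) {u : 𝓧 → 𝓤}
    (hu : Measurable u) {W : Ω → 𝓦} (hW : Measurable W)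
    (h : W ⟂ᵢ[fun ω => u (X ω), hu.comp hX; μ] X) :
    ∀ᵐ ω ∂μ, (condExpKernel μ (m𝓤.comap fun ω => u (X ω)) ω).map W =
      (condExpKernel μ (m𝓧.comap X) ω).map W := by
  have hU : Measurable fun ω => u (X ω) := hu.comp hX
  have hprob : ∀ ν : Measure Ω, IsProbabilityMeasure ν → IsProbabilityMeasure (ν.map W) :=
    fun ν _ => Measure.isProbabilityMeasure_map hW.aemeasurable
  have := fun ω => hprob (condExpKernel μ (m𝓤.comap fun ω => u (X ω)) ω) inferInstance
  have := fun ω => hprob (condExpKernel μ (m𝓧.comap X) ω) inferInstance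
  have h1 := (condIndepFun_iff_condDistrib_prod_ae_eq_prodMkRight hW hX hU).1 h.symm
  have h1 := ae_of_ae_map (by fun_prop) h1
  -- Adjoining `u (X)` to `X` adds no information, so conditioning on the pair is conditioning on
  -- `X`.
  have hcomap :
      MeasurableSpace.comap (fun ω => (u (X ω), X ω)) Prod.instMeasurableSpace = m𝓧.comap X := by
    refine le_antisymm ?_ ?_
    · exact ((hu.comp (comap_measurable X)).prodMk (comap_measurable X)).comap_le
    · exact (measurable_snd.comp (comap_measurable fun ω => (u (X ω), X ω))).comap_le
  refine ae_eq_measure_of_forall_measurableSet fun s hs => ?_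
  have h2 := condDistrib_apply_ae_eq_condExpKernel_map (μ := μ) hW hU hs
  have h3 := condDistrib_apply_ae_eq_condExpKernel_map (μ := μ) hW (hU.prodMk hX) hs
  rw [hcomap] at h3
  filter_upwards [h1, h2, h3] with ω h1 h2 h3
  rw [Kernel.map_apply _ hW] at h2 h3
  rw [← h2, ← h3, h1]
  rfl

end Independence

/-! ### Regressions of `W` and `T` under the conditional laws given `Z` -/

section Regression

variable {𝓧 𝓤 𝓥 𝓩 𝓦 𝓣 : Type*} {m𝓧 : MeasurableSpace 𝓧} [StandardBorelSpace 𝓧] [Nonempty 𝓧]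
  {m𝓤 : MeasurableSpace 𝓤} {m𝓥 : MeasurableSpace 𝓥} {m𝓩 : MeasurableSpace 𝓩}
  {m𝓦 : MeasurableSpace 𝓦} [StandardBorelSpace 𝓦] [Nonempty 𝓦]
  {m𝓣 : MeasurableSpace 𝓣} [StandardBorelSpace 𝓣] [Nonempty 𝓣]
  {μ : Measure Ω} [IsFiniteMeasure μ]
  {X : Ω → 𝓧} (hX : Measurable X) {u : 𝓧 → 𝓤} (hu : Measurable u) {v : 𝓧 → 𝓥}
  (hv : Measurable v) {z : 𝓧 → 𝓩} (hz : Measurable z) {W : Ω → 𝓦} {T : Ω → 𝓣}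

/-- If `W` and `T` are conditionally independent given `X` and depend on `X` only through `U` and
`V` respectively, then under the conditional law given a function `Z` of `X` the regressions
`E (h(W) | U)` and `E (j(T) | V)` have the same means and the same mean product as
`h(W)` and `j(T)`. -/
theorem ae_integral_condMean (hz : Measurable z) (hW : Measurable W) (hT : Measurable T)
    (hWT : W ⟂ᵢ[X, hX; μ] T)
    (hWU : W ⟂ᵢ[fun ω => u (X ω), hu.comp hX; μ] X)
    (hTV : T ⟂ᵢ[fun ω => v (X ω), hv.comp hX; μ] X)
    {h : 𝓦 → ℝ} (hh : Measurable h) {j : 𝓣 → ℝ} (hj : Measurable j) {C : ℝ}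
    (hC : ∀ x, ‖j x‖ ≤ C) :
    ∀ᵐ ω ∂μ, ∀ ν : Measure Ω, ν = condExpKernel μ (m𝓩.comap fun ω => z (X ω)) ω →
      Integrable (fun ω => h (W ω)) ν →
      ∀ F G : Ω → ℝ, F = condMean μ (fun ω => u (X ω)) (fun ω => h (W ω)) →
        G = condMean μ (fun ω => v (X ω)) (fun ω => j (T ω)) →
        Integrable F ν ∧ Integrable G ν ∧ Integrable (fun x => F x * G x) ν ∧
          ∫ x, F x ∂ν = ∫ x, h (W x) ∂ν ∧ ∫ x, G x ∂ν = ∫ x, j (T x) ∂ν ∧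
          ∫ x, F x * G x ∂ν = ∫ x, h (W x) * j (T x) ∂ν := by
  have hZ : Measurable fun ω => z (X ω) := hz.comp hX
  have hle : (m𝓩.comap fun ω => z (X ω)) ≤ m𝓧.comap X :=
    (hz.comp (comap_measurable X)).comap_le
  have htower := ae_fullCondExpKernel_comp_condExpKernel μ hle hX.comap_le
  have hF := ae_ae_condExpKernel_of_ae hZ.comap_le
    (CondIndepFun.ae_map_condExpKernel_eq hX hu hW hWU)
  have hG := ae_ae_condExpKernel_of_ae hZ.comap_le
    (CondIndepFun.ae_map_condExpKernel_eq hX hv hT hTV)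
  have hI := ae_ae_condExpKernel_of_ae hZ.comap_le (CondIndepFun.ae_indepFun hW hT hX hWT)
  filter_upwards [htower, hF, hG, hI] with ω htower hF hG hI
  rintro ν rfl hint F G rfl rfl
  set ν := condExpKernel μ (m𝓩.comap fun ω => z (X ω)) ω with hν
  set K := fullCondExpKernel μ hX.comap_le with hK
  -- Both regressions may be taken given `X` instead; their product is then the regression of `h(W)
  -- j(T)` by independence given `X`.
  have hF' : condMean μ (fun ω => u (X ω)) (fun ω => h (W ω)) =ᵐ[ν]
      fun x => ∫ y, h (W y) ∂K x := by
    filter_upwards [hF] with x hx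
    rw [condMean, ← integral_map (φ := W) hW.aemeasurable hh.aestronglyMeasurable, hx,
      integral_map hW.aemeasurable hh.aestronglyMeasurable]
    rfl
  have hG' : condMean μ (fun ω => v (X ω)) (fun ω => j (T ω)) =ᵐ[ν]
      fun x => ∫ y, j (T y) ∂K x := by
    filter_upwards [hG] with x hx
    rw [condMean, ← integral_map (φ := T) hT.aemeasurable hj.aestronglyMeasurable, hx,
      integral_map hT.aemeasurable hj.aestronglyMeasurable]
    rfl
  have hFG' : (fun x => condMean μ (fun ω => u (X ω)) (fun ω => h (W ω)) x *
      condMean μ (fun ω => v (X ω)) (fun ω => j (T ω)) x) =ᵐ[ν]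
      fun x => ∫ y, h (W y) * j (T y) ∂K x := by
    filter_upwards [hF', hG', hI] with x hx hx' hI
    rw [hx, hx']
    exact ((hI.comp hh hj).integral_fun_mul_eq_mul_integral
      (hh.comp hW).aestronglyMeasurable (hj.comp hT).aestronglyMeasurable).symm
  have hjT : Integrable (fun ω => j (T ω)) ν :=
    Integrable.of_bound (hj.comp hT).aestronglyMeasurable C (ae_of_all _ fun _ => hC _)
  have hhj : Integrable (fun ω => h (W ω) * j (T ω)) ν :=
    hint.mul_bdd (c := C) (hj.comp hT).aestronglyMeasurable (ae_of_all _ fun _ => hC _)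
  have key : ∀ {f : Ω → ℝ}, Integrable f ν → Integrable (fun x => ∫ y, f y ∂K x) ν ∧
      ∫ x, ∫ y, f y ∂K x ∂ν = ∫ x, f x ∂ν := by
    intro f hf
    have hf' : Integrable f (K ∘ₘ ν) := by rwa [htower]
    refine ⟨integrable_integral_of_integrable_comp hf', ?_⟩
    rw [← integral_measure_comp hf', htower]
  refine ⟨(key hint).1.congr hF'.symm, (key hjT).1.congr hG'.symm, (key hhj).1.congr hFG'.symm,
    ?_, ?_, ?_⟩
  · rw [integral_congr_ae hF', (key hint).2]
  · rw [integral_congr_ae hG', (key hjT).2]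
  · rw [integral_congr_ae hFG', (key hhj).2]

theorem condCov_condMean_ae_eq_zero (hW : Measurable W) (hT : Measurable T)
    (hWT : W ⟂ᵢ[X, hX; μ] T)
    (hWU : W ⟂ᵢ[fun ω => u (X ω), hu.comp hX; μ] X)
    (hTV : T ⟂ᵢ[fun ω => v (X ω), hv.comp hX; μ] X)
    (hZ : W ⟂ᵢ[fun ω => z (X ω), hz.comp hX; μ] T)
    {h : 𝓦 → ℝ} (hh : Measurable h) (hint : CondIntegrable μ (fun ω => z (X ω)) fun ω => h (W ω))
    {j : 𝓣 → ℝ} (hj : Measurable j) {C : ℝ} (hC : ∀ x, ‖j x‖ ≤ C) :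
    condCov μ (fun ω => z (X ω)) (condMean μ (fun ω => u (X ω)) fun ω => h (W ω))
      (condMean μ (fun ω => v (X ω)) fun ω => j (T ω)) =ᵐ[μ] 0 := by
  filter_upwards [ae_integral_condMean hX hu hv hz hW hT hWT hWU hTV hh hj hC, hint,
    CondIndepFun.ae_indepFun hW hT (hz.comp hX) hZ] with ω hω hint hI
  obtain ⟨hF, hG, hFG, eF, eG, eFG⟩ := hω _ rfl hint _ _ rfl rfl
  rw [condCov, covariance]
  set ν := condExpKernel μ (m𝓩.comap fun ω => z (X ω)) ω with hν
  set F := condMean μ (fun ω => u (X ω)) fun ω => h (W ω)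
  set G := condMean μ (fun ω => v (X ω)) fun ω => j (T ω)
  have hprod : ∫ x, F x * G x ∂ν = (∫ x, F x ∂ν) * ∫ x, G x ∂ν := by
    rw [eF, eG, eFG]
    exact (hI.comp hh hj).integral_fun_mul_eq_mul_integral
      (hh.comp hW).aestronglyMeasurable (hj.comp hT).aestronglyMeasurable
  -- `F` is only known to be integrable, not square integrable, so the covariance is expanded by
  -- hand.
  have hexp : ∀ x, (F x - ∫ x, F x ∂ν) * (G x - ∫ x, G x ∂ν) =
      F x * G x - F x * (∫ x, G x ∂ν) - (∫ x, F x ∂ν) * G x +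
        (∫ x, F x ∂ν) * ∫ x, G x ∂ν := fun x => by ring
  have i1 : Integrable (fun x => F x * ∫ x, G x ∂ν) ν := hF.mul_const _
  have i2 : Integrable (fun x => (∫ x, F x ∂ν) * G x) ν := hG.const_mul _
  have i3 : Integrable (fun x => F x * G x - F x * ∫ x, G x ∂ν) ν := hFG.sub i1
  have i4 : Integrable (fun x => F x * G x - F x * (∫ x, G x ∂ν) - (∫ x, F x ∂ν) * G x) ν :=
    i3.sub i2
  rw [integral_congr_ae (ae_of_all _ hexp), integral_add i4 (integrable_const _),
    integral_sub i3 i2, integral_sub hFG i1, integral_mul_const, integral_const_mul, hprod]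
  simp

theorem condIndepFun_of_condIndepFun_reduced (hW : Measurable W) (hT : Measurable T)
    (hWT : W ⟂ᵢ[X, hX; μ] T)
    (hWU : W ⟂ᵢ[fun ω => u (X ω), hu.comp hX; μ] X)
    (hTV : T ⟂ᵢ[fun ω => v (X ω), hv.comp hX; μ] X)
    [MeasurableSpace.CountablyGenerated 𝓤] [MeasurableSpace.CountablyGenerated 𝓥]
    (hUV : (fun ω => u (X ω)) ⟂ᵢ[fun ω => z (X ω), hz.comp hX; μ] (fun ω => v (X ω))) :
    W ⟂ᵢ[fun ω => z (X ω), hz.comp hX; μ] T := by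
  refine (condIndepFun_iff_condExp_inter_preimage_eq_mul hW hT).2 fun s t hs ht => ?_
  have hZ : Measurable fun ω => z (X ω) := hz.comp hX
  have h1 := condExpKernel_ae_eq_condExp (μ := μ) hZ.comap_le ((hW hs).inter (hT ht))
  have h2 := condExpKernel_ae_eq_condExp (μ := μ) hZ.comap_le (hW hs)
  have h3 := condExpKernel_ae_eq_condExp (μ := μ) hZ.comap_le (hT ht)
  have hhs : Measurable (s.indicator fun _ => (1 : ℝ)) := measurable_const.indicator hs
  have hht : Measurable (t.indicator fun _ => (1 : ℝ)) := measurable_const.indicator ht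
  have hC : ∀ x, ‖t.indicator (fun _ => (1 : ℝ)) x‖ ≤ 1 := fun x =>
    (norm_indicator_le_norm_self _ _).trans (by simp)
  filter_upwards [ae_integral_condMean hX hu hv hz hW hT hWT hWU hTV hhs hht hC,
    CondIndepFun.ae_indepFun (hu.comp hX) (hv.comp hX) hZ hUV, h1, h2, h3] with ω hω hI h1 h2 h3
  obtain ⟨hF, hG, hFG, eF, eG, eFG⟩ := hω _ rfl
    (Integrable.of_bound (hhs.comp hW).aestronglyMeasurable 1 (ae_of_all _ fun x =>
      (norm_indicator_le_norm_self _ _).trans (by simp))) _ _ rfl rfl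
  rw [← h1, ← h2, ← h3]
  set ν := condExpKernel μ (m𝓩.comap fun ω => z (X ω)) ω with hν
  set F := condMean μ (fun ω => u (X ω)) fun ω => s.indicator (fun _ => (1 : ℝ)) (W ω) with hFdef
  set G := condMean μ (fun ω => v (X ω)) fun ω => t.indicator (fun _ => (1 : ℝ)) (T ω) with hGdef
  -- `F` and `G` are functions of `U` and `V`, hence inherit their independence under `ν`.
  have hFm : Measurable[m𝓤.comap fun ω => u (X ω)] F :=
    (hhs.comp hW).stronglyMeasurable.integral_condExpKernel.measurable
  have hGm : Measurable[m𝓥.comap fun ω => v (X ω)] G :=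
    (hht.comp hT).stronglyMeasurable.integral_condExpKernel.measurable
  have hFGI : IndepFun F G ν := by
    rw [IndepFun_iff_Indep] at hI ⊢
    exact indep_of_indep_of_le_left (indep_of_indep_of_le_right hI hGm.comap_le) hFm.comap_le
  have e := hFGI.integral_fun_mul_eq_mul_integral hF.1 hG.1
  rw [eFG, eF, eG] at e
  have i1 : ∀ x, s.indicator (fun _ => (1 : ℝ)) (W x) * t.indicator (fun _ => (1 : ℝ)) (T x) =
      (W ⁻¹' s ∩ T ⁻¹' t).indicator 1 x := fun x => by
    by_cases hx : W x ∈ s <;> by_cases hx' : T x ∈ t <;> simp [hx, hx']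
  have i2 : ∀ x, s.indicator (fun _ => (1 : ℝ)) (W x) = (W ⁻¹' s).indicator 1 x := fun x => rfl
  have i3 : ∀ x, t.indicator (fun _ => (1 : ℝ)) (T x) = (T ⁻¹' t).indicator 1 x := fun x => rfl
  simp_rw [i1] at e
  simp_rw [i2, i3] at e
  rwa [integral_indicator_one ((hW hs).inter (hT ht)), integral_indicator_one (hW hs),
    integral_indicator_one (hT ht)] at e

end Regression

end IteratedConditioning

/-! ### Conditional independence of linear images of a Gaussian vector -/

section ConditionalIndependence

variable {Ω : Type*} [MeasurableSpace Ω] [StandardBorelSpace Ω]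
  {𝓖 : Type*} [MeasurableSpace 𝓖] [StandardBorelSpace 𝓖] [Nonempty 𝓖]
  {𝓕 : Type*} [MeasurableSpace 𝓕] [StandardBorelSpace 𝓕] [Nonempty 𝓕]
  {𝓚 : Type*} [MeasurableSpace 𝓚] [StandardBorelSpace 𝓚] [Nonempty 𝓚]

/-- Given `k`, the variable `k` is constant, so it can be adjoined freely. This later permits shifts
by functions of `X_A`. -/
theorem CondIndepFun.prodMk_self_left {μ : Measure Ω} [IsFiniteMeasure μ]
    {g : Ω → 𝓖} (hg : Measurable g) {f : Ω → 𝓕} (hf : Measurable f) {k : Ω → 𝓚}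
    (hk : Measurable k) (h : g ⟂ᵢ[k, hk; μ] f) :
    (fun ω => (g ω, k ω)) ⟂ᵢ[k, hk; μ] f := by
  obtain ⟨κ, hκ, h⟩ := (condIndepFun_iff_exists_kernel hg hf hk).1 h
  refine (condIndepFun_iff_exists_kernel (hg.prodMk hk) hf hk).2 ⟨κ, hκ, ?_⟩
  refine Measure.ext_prod fun {D t} hD ht => ?_
  have hφ : Measurable fun x : 𝓚 × 𝓖 => (x.1, (x.2, x.1)) := by fun_prop
  have h' := congrArg (fun m => m (((fun x : 𝓚 × 𝓖 => (x.1, (x.2, x.1))) ⁻¹' D) ×ˢ t)) h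
  rw [Measure.map_apply (by fun_prop) ((hφ hD).prod ht),
    Measure.compProd_apply_prod (hφ hD) ht,
    setLIntegral_map (hφ hD) (Kernel.measurable_coe _ ht) (by fun_prop)] at h'
  rw [Measure.map_apply (by fun_prop) (hD.prod ht), Measure.compProd_apply_prod hD ht,
    setLIntegral_map hD (Kernel.measurable_coe _ ht) (by fun_prop)]
  exact h'

theorem CondIndepFun.comp_prodMk {β γ : Type*} [MeasurableSpace β] [MeasurableSpace γ]
    {μ : Measure Ω} [IsFiniteMeasure μ]
    {g : Ω → 𝓖} (hg : Measurable g) {f : Ω → 𝓕} (hf : Measurable f) {k : Ω → 𝓚}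
    (hk : Measurable k) (h : g ⟂ᵢ[k, hk; μ] f) {φ : 𝓖 × 𝓚 → β} (hφ : Measurable φ)
    {ψ : 𝓕 × 𝓚 → γ} (hψ : Measurable ψ) :
    (fun ω => φ (g ω, k ω)) ⟂ᵢ[k, hk; μ] (fun ω => ψ (f ω, k ω)) := by
  have h1 := CondIndepFun.prodMk_self_left hg hf hk h
  have h2 := CondIndepFun.prodMk_self_left hf (hg.prodMk hk) hk h1.symm
  exact h2.symm.comp hφ hψ

/-- Conditional probabilities given `Z` of events in `(f, g)` are constants, namely the
unconditional ones. -/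
theorem condIndepFun_iff_indepFun_of_indepFun {β γ 𝓩 : Type*} [MeasurableSpace β]
    [MeasurableSpace γ] [MeasurableSpace 𝓩] {μ : Measure Ω} [IsProbabilityMeasure μ]
    {f : Ω → β} (hf : Measurable f) {g : Ω → γ} (hg : Measurable g) {Z : Ω → 𝓩}
    (hZ : Measurable Z) (h : (fun ω => (f ω, g ω)) ⟂ᵢ[μ] Z) :
    f ⟂ᵢ[Z, hZ; μ] g ↔ f ⟂ᵢ[μ] g := by
  have hfg : Measurable fun ω => (f ω, g ω) := hf.prodMk hg
  have key : ∀ S : Set (β × γ), MeasurableSet S →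
      μ⟦(fun ω => (f ω, g ω)) ⁻¹' S | MeasurableSpace.comap Z inferInstance⟧ =ᵐ[μ]
        fun _ => μ.real ((fun ω => (f ω, g ω)) ⁻¹' S) := by
    intro S hS
    have hm : MeasurableSet[MeasurableSpace.comap (fun ω => (f ω, g ω)) inferInstance]
        ((fun ω => (f ω, g ω)) ⁻¹' S) := ⟨S, hS, rfl⟩
    have := condExp_indep_eq hfg.comap_le hZ.comap_le
      ((stronglyMeasurable_const (β := ℝ) (b := 1)).indicator hm) ((IndepFun_iff_Indep _ _ _).1 h)
    refine this.trans (Filter.EventuallyEq.of_eq ?_)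
    funext ω
    exact integral_indicator_one (hfg hS)
  rw [condIndepFun_iff_condExp_inter_preimage_eq_mul hf hg,
    indepFun_iff_measure_inter_preimage_eq_mul]
  refine forall₂_congr fun s t => forall₂_congr fun hs ht => ?_
  have k1 := key (s ×ˢ t) (hs.prod ht)
  have k2 := key (s ×ˢ Set.univ) (hs.prod .univ)
  have k3 := key (Set.univ ×ˢ t) (MeasurableSet.univ.prod ht)
  rw [Set.mk_preimage_prod] at k1 k2 k3
  rw [Set.preimage_univ, Set.inter_univ] at k2
  rw [Set.preimage_univ, Set.univ_inter] at k3
  have e : μ (f ⁻¹' s ∩ g ⁻¹' t) = μ (f ⁻¹' s) * μ (g ⁻¹' t) ↔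
      μ.real (f ⁻¹' s ∩ g ⁻¹' t) = μ.real (f ⁻¹' s) * μ.real (g ⁻¹' t) := by
    simp only [measureReal_def]
    rw [← ENNReal.toReal_mul, ENNReal.toReal_eq_toReal_iff' (by finiteness) (by finiteness)]
  rw [e]
  constructor
  · intro h'
    obtain ⟨ω, h1, h2, h3, h4⟩ := (h'.and (k1.and (k2.and k3))).exists
    exact h2.symm.trans (h1.trans (congrArg₂ (· * ·) h3 h4))
  · intro h'
    filter_upwards [k1, k2, k3] with ω h1 h2 h3
    rw [h1, h2, h3, h']

end ConditionalIndependence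

/-! ### Gaussian vectors and their regression residuals -/

section Gaussian

theorem pi_absolutelyContinuous {n : ℕ} {μ ν : Fin n → Measure ℝ} [∀ i, SigmaFinite (μ i)]
    [∀ i, SigmaFinite (ν i)] (h : ∀ i, μ i ≪ ν i) : Measure.pi μ ≪ Measure.pi ν := by
  induction n with
  | zero => rw [Measure.pi_of_empty μ, Measure.pi_of_empty ν]
  | succ n ih =>
    let e := MeasurableEquiv.piFinSuccAbove (fun _ : Fin (n + 1) => ℝ) 0
    have h1 := (measurePreserving_piFinSuccAbove μ 0).symm e
    have h2 := (measurePreserving_piFinSuccAbove ν 0).symm e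
    rw [← h1.map_eq, ← h2.map_eq]
    exact ((h 0).prod (ih fun i => h _)).map e.symm.measurable

variable {Ω : Type*} [MeasurableSpace Ω] {ν : Measure Ω} {p : ℕ} {X : Ω → Fin p → ℝ}

theorem HasGaussianLaw.mulVec {ι : Type*} [Fintype ι] (hX : HasGaussianLaw X ν)
    (B : Matrix ι (Fin p) ℝ) : HasGaussianLaw (fun ω => B *ᵥ X ω) ν :=
  hX.map_fun (LinearMap.toContinuousLinearMap B.mulVecLin)

theorem covariance_mulVec_mulVec {ι κ : Type*} [Fintype ι] [Fintype κ] [IsFiniteMeasure ν]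
    (hX : ∀ i, MemLp (fun ω => X ω i) 2 ν)
    (B : Matrix ι (Fin p) ℝ) (D : Matrix κ (Fin p) ℝ) (i : ι) (j : κ) :
    cov[fun ω => (B *ᵥ X ω) i, fun ω => (D *ᵥ X ω) j; ν] =
      (B * (Matrix.of fun i j => cov[fun ω => X ω i, fun ω => X ω j; ν]) * Dᵀ) i j := by
  simp only [Matrix.mulVec, dotProduct]
  rw [covariance_fun_sum_fun_sum (fun k => (hX k).const_mul _) (fun k => (hX k).const_mul _)]
  simp only [Matrix.mul_apply, Matrix.transpose_apply, Matrix.of_apply, covariance_const_mul_left,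
    covariance_const_mul_right, Finset.sum_mul]
  rw [Finset.sum_comm]
  exact Finset.sum_congr rfl fun _ _ => Finset.sum_congr rfl fun _ _ => by ring

theorem HasGaussianLaw.memLp_apply (hX : HasGaussianLaw X ν) (i : Fin p) :
    MemLp (fun ω => X ω i) 2 ν :=
  (HasGaussianLaw.eval (X := fun i ω => X ω i) hX i).memLp_two

theorem HasGaussianLaw.indepFun_mulVec_iff {ι κ : Type*} [Fintype ι] [Fintype κ]
    (hX : HasGaussianLaw X ν) (B : Matrix ι (Fin p) ℝ) (D : Matrix κ (Fin p) ℝ) :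
    (fun ω => B *ᵥ X ω) ⟂ᵢ[ν] (fun ω => D *ᵥ X ω) ↔
      B * (Matrix.of fun i j => cov[fun ω => X ω i, fun ω => X ω j; ν]) * Dᵀ = 0 := by
  have := hX.isProbabilityMeasure
  constructor
  · intro h
    ext i j
    rw [← covariance_mulVec_mulVec (HasGaussianLaw.memLp_apply hX)]
    have hB := HasGaussianLaw.eval (X := fun i ω => (B *ᵥ X ω) i)
      (HasGaussianLaw.mulVec hX B) i
    have hD := HasGaussianLaw.eval (X := fun i ω => (D *ᵥ X ω) i)
      (HasGaussianLaw.mulVec hX D) j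
    exact (h.comp (measurable_pi_apply i) (measurable_pi_apply j)).covariance_eq_zero
      hB.memLp_two hD.memLp_two
  · intro h
    refine HasGaussianLaw.indepFun_of_covariance_eval (X := fun i ω => (B *ᵥ X ω) i)
      (Y := fun j ω => (D *ᵥ X ω) j) ?_ fun i j => ?_
    · exact hX.map_fun ((LinearMap.toContinuousLinearMap B.mulVecLin).prod
        (LinearMap.toContinuousLinearMap D.mulVecLin))
    · rw [covariance_mulVec_mulVec (HasGaussianLaw.memLp_apply hX), h]
      rfl

/-- The law of a Gaussian vector with nondegenerate covariance is equivalent to the Lebesgue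
measure. -/
theorem HasGaussianLaw.map_equivalent_volume (hXm : Measurable X) (hX : HasGaussianLaw X ν)
    (hS : (Matrix.of fun i j => cov[fun ω => X ω i, fun ω => X ω j; ν]).PosDef) :
    ν.map X ≪ volume ∧ volume ≪ ν.map X := by
  have := hX.isProbabilityMeasure
  set S : Matrix (Fin p) (Fin p) ℝ :=
    Matrix.of fun i j => cov[fun ω => X ω i, fun ω => X ω j; ν] with hSdef
  -- In an eigenbasis of the covariance the coordinates are independent with positive variances, so
  -- their law is a product of nondegenerate real Gaussians. The map `x ↦ U x` brings it back,
  -- sending Lebesgue measure to a nonzero multiple of itself.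
  set U : Matrix (Fin p) (Fin p) ℝ :=
    (hS.isHermitian.eigenvectorUnitary : Matrix (Fin p) (Fin p) ℝ) with hU
  have hUU : U * Uᵀ = 1 := by
    have := Unitary.mul_star_self_of_mem hS.isHermitian.eigenvectorUnitary.2
    rwa [Matrix.star_eq_conjTranspose, Matrix.conjTranspose_eq_transpose_of_trivial] at this
  have hdiag : Uᵀ * S * U = Matrix.diagonal hS.isHermitian.eigenvalues := by
    have := hS.isHermitian.conjStarAlgAut_star_eigenvectorUnitary
    rw [Unitary.conjStarAlgAut_star_apply, Matrix.star_eq_conjTranspose,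
      Matrix.conjTranspose_eq_transpose_of_trivial] at this
    exact this
  have hdet : U.det ≠ 0 := by
    intro h0
    have := congrArg Matrix.det hUU
    rw [Matrix.det_mul, h0, zero_mul, Matrix.det_one] at this
    exact zero_ne_one this
  have hcov : ∀ i j, cov[fun ω => (Uᵀ *ᵥ X ω) i, fun ω => (Uᵀ *ᵥ X ω) j; ν] =
      Matrix.diagonal hS.isHermitian.eigenvalues i j := fun i j => by
    rw [covariance_mulVec_mulVec (HasGaussianLaw.memLp_apply hX), Matrix.transpose_transpose, ← hSdef, hdiag]
  have hY := HasGaussianLaw.mulVec hX Uᵀ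
  have hYm : ∀ M : Matrix (Fin p) (Fin p) ℝ, Measurable fun x : Fin p → ℝ => M *ᵥ x := fun M =>
    (LinearMap.toContinuousLinearMap M.mulVecLin).continuous.measurable
  have hYi := fun i => HasGaussianLaw.eval (X := fun i ω => (Uᵀ *ᵥ X ω) i) hY i
  have hind : iIndepFun (fun i ω => (Uᵀ *ᵥ X ω) i) ν :=
    HasGaussianLaw.iIndepFun_of_covariance_eq_zero (X := fun i ω => (Uᵀ *ᵥ X ω) i) hY
      fun i j hij => by rw [hcov, Matrix.diagonal_apply_ne _ hij]
  have hpi := (iIndepFun_iff_map_fun_eq_pi_map fun i => (hYi i).aemeasurable).1 hind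
  have hvar : ∀ i, (Var[fun ω => (Uᵀ *ᵥ X ω) i; ν]).toNNReal ≠ 0 := fun i => by
    rw [← covariance_self (hYi i).aemeasurable, hcov, Matrix.diagonal_apply_eq]
    simpa using hS.eigenvalues_pos i
  have hmapi := fun i => (hYi i).map_eq_gaussianReal
  have : ∀ i, IsProbabilityMeasure (ν.map fun ω => (Uᵀ *ᵥ X ω) i) := fun i =>
    Measure.isProbabilityMeasure_map (hYi i).aemeasurable
  have hY1 : (ν.map fun ω => Uᵀ *ᵥ X ω) ≪ volume := by
    rw [volume_pi]
    refine hpi ▸ pi_absolutelyContinuous fun i => ?_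
    rw [hmapi]
    exact gaussianReal_absolutelyContinuous _ (hvar i)
  have hY2 : volume ≪ (ν.map fun ω => Uᵀ *ᵥ X ω) := by
    rw [volume_pi]
    refine hpi ▸ pi_absolutelyContinuous fun i => ?_
    rw [hmapi]
    exact gaussianReal_absolutelyContinuous' _ (hvar i)
  have hback : ν.map X = (ν.map fun ω => Uᵀ *ᵥ X ω).map fun x => U *ᵥ x := by
    refine Eq.trans ?_ (Measure.map_map (hYm U) ((hYm Uᵀ).comp hXm)).symm
    congr 1
    funext ω
    simp [Matrix.mulVec_mulVec, hUU]
  have hvol : (volume : Measure (Fin p → ℝ)).map (fun x => U *ᵥ x) =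
      ENNReal.ofReal |(U.det)⁻¹| • volume :=
    Real.map_matrix_volume_pi_eq_smul_volume_pi hdet
  rw [hback]
  constructor
  · refine (hY1.map (hYm U)).trans ?_
    rw [hvol]
    exact Measure.smul_absolutelyContinuous
  · refine Measure.AbsolutelyContinuous.trans ?_ (hY2.map (hYm U))
    rw [hvol]
    exact Measure.absolutelyContinuous_smul (by simpa using hdet)

theorem HasGaussianLaw.condIndepFun_reduced_iff [StandardBorelSpace Ω] [IsFiniteMeasure ν]
    (hXm : Measurable X) (hX : HasGaussianLaw X ν)
    {S : Matrix (Fin p) (Fin p) ℝ}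
    (hS : S = Matrix.of fun i j => cov[fun ω => X ω i, fun ω => X ω j; ν]) (hpos : S.PosDef)
    {a b : ℕ} (βY : Matrix (Fin p) (Fin a) ℝ) (βT : Matrix (Fin p) (Fin b) ℝ)
    (A : Finset (Fin p)) :
    reduced βY X ⟂ᵢ[subvector X A, measurable_subvector hXm A; ν] reduced βT X ↔
      βYᵀ * residualForm S A * βT = 0 := by
  have := hX.isProbabilityMeasure
  have hmul : ∀ {m n : Type} [Fintype m] [Fintype n] (M : Matrix m n ℝ),
      Measurable fun x : n → ℝ => M *ᵥ x := fun M =>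
    (LinearMap.toContinuousLinearMap M.mulVecLin).continuous.measurable
  -- `C` holds the coefficients of the regression of `X` on `X_A`, and `Q X` is the residual up to
  -- an additive constant; its covariance is the residual form.
  set C := S * idCols A * ((idCols A)ᵀ * S * idCols A)⁻¹ with hC
  set Q := 1 - C * (idCols A)ᵀ with hQ
  have hQS : Q * S = residualForm S A := by
    rw [hQ, hC, residualForm, proj, Matrix.sub_mul, Matrix.one_mul]
    simp only [Matrix.mul_assoc]
  have hQSI : Q * S * idCols A = 0 := by rw [hQS, residualForm_mul_idCols hpos]
  have hQSQ : Q * S * Qᵀ = residualForm S A := by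
    have : Qᵀ = 1 - idCols A * Cᵀ := by
      rw [hQ, Matrix.transpose_sub, Matrix.transpose_one, Matrix.transpose_mul,
        Matrix.transpose_transpose]
    rw [this, Matrix.mul_sub, Matrix.mul_one, ← Matrix.mul_assoc, hQSI, Matrix.zero_mul, sub_zero,
      hQS]
  have hZ : subvector X A = fun ω => (idCols A)ᵀ *ᵥ X ω := by
    funext ω
    rw [transpose_idCols_mulVec]
    rfl
  have hZm := measurable_subvector hXm A
  have hRZ : (fun ω => Q *ᵥ X ω) ⟂ᵢ[ν] subvector X A := by
    rw [hZ, HasGaussianLaw.indepFun_mulVec_iff hX, ← hS, Matrix.transpose_transpose, hQSI]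
  have hRm : Measurable fun ω => Q *ᵥ X ω := (hmul Q).comp hXm
  have hdec : ∀ {d : ℕ} (β : Matrix (Fin p) (Fin d) ℝ), reduced β X =
      fun ω => βᵀ *ᵥ (Q *ᵥ X ω) + (βᵀ * C) *ᵥ subvector X A ω := by
    intro d β
    funext ω
    rw [hZ, reduced]
    simp only [Matrix.mulVec_mulVec, ← Matrix.add_mulVec]
    congr 1
    rw [hQ, Matrix.mul_sub, Matrix.mul_one, Matrix.mul_assoc βᵀ C, sub_add_cancel]
  have hm : ∀ {d : ℕ} (β : Matrix (Fin p) (Fin d) ℝ), Measurable fun ω => βᵀ *ᵥ (Q *ᵥ X ω) :=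
    fun β => (hmul βᵀ).comp hRm
  have hshift : ∀ {d : ℕ} (M : Matrix (Fin d) {i // i ∈ A} ℝ),
      Measurable fun x : (Fin d → ℝ) × ({i // i ∈ A} → ℝ) => x.1 + M *ᵥ x.2 := fun M =>
    measurable_fst.add ((hmul M).comp measurable_snd)
  -- Each reduced predictor differs from its residual part by a function of the conditioning
  -- variable.
  have step1 : reduced βY X ⟂ᵢ[subvector X A, hZm; ν] reduced βT X ↔
      (fun ω => βYᵀ *ᵥ (Q *ᵥ X ω)) ⟂ᵢ[subvector X A, hZm; ν] (fun ω => βTᵀ *ᵥ (Q *ᵥ X ω)) := by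
    constructor
    · intro h
      have := CondIndepFun.comp_prodMk (measurable_reduced βY hXm) (measurable_reduced βT hXm) hZm
        h (hshift (-(βYᵀ * C))) (hshift (-(βTᵀ * C)))
      simpa only [hdec, Matrix.neg_mulVec, add_neg_cancel_right] using this
    · intro h
      have := CondIndepFun.comp_prodMk (hm βY) (hm βT) hZm h (hshift (βYᵀ * C)) (hshift (βTᵀ * C))
      simpa only [hdec] using this
  have hind : (fun ω => (βYᵀ *ᵥ (Q *ᵥ X ω), βTᵀ *ᵥ (Q *ᵥ X ω))) ⟂ᵢ[ν] subvector X A :=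
    hRZ.comp ((hmul βYᵀ).prodMk (hmul βTᵀ)) measurable_id
  rw [step1, condIndepFun_iff_indepFun_of_indepFun (hm βY) (hm βT) hZm hind]
  simp only [Matrix.mulVec_mulVec]
  rw [HasGaussianLaw.indepFun_mulVec_iff hX, ← hS, Matrix.transpose_mul,
    Matrix.transpose_transpose, ← hQSQ]
  simp only [Matrix.mul_assoc]

end Gaussian

/-! ### Central subspaces and adjustment sets in the treatment groups -/

section Groups

/-- The overall law is a mixture of the group laws. -/
theorem map_absolutelyContinuous_map_group {Ω 𝓧 : Type*} [MeasurableSpace Ω]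
    [MeasurableSpace 𝓧] {μ : Measure Ω} [IsFiniteMeasure μ] {T : Ω → Fin 2} {Z : Ω → 𝓧}
    (hZ : Measurable Z) (hT : Measurable T) {s : Fin 2}
    (h : ∀ s', (group μ T s').map Z ≪ (group μ T s).map Z) :
    μ.map Z ≪ (group μ T s).map Z := by
  refine Measure.AbsolutelyContinuous.mk fun D hD h0 => ?_
  rw [Measure.map_apply hZ hD]
  have hnull : ∀ s', μ (T ⁻¹' {s'} ∩ Z ⁻¹' D) = 0 := fun s' => by
    have := h s' h0
    rw [Measure.map_apply hZ hD, group, cond_apply (hT (measurableSet_singleton s')),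
      mul_eq_zero, ENNReal.inv_eq_zero] at this
    exact this.resolve_left (measure_ne_top _ _)
  refine measure_mono_null (fun ω hω => ?_) (measure_iUnion_null hnull)
  exact Set.mem_iUnion.2 ⟨T ω, rfl, hω⟩

variable {Ω : Type*} [MeasurableSpace Ω] [StandardBorelSpace Ω] {μ : Measure Ω}
  [IsFiniteMeasure μ] {p : ℕ} {X : Ω → Fin p → ℝ} (hX : Measurable X) {T : Ω → Fin 2}

theorem measurable_transpose_mulVec {d : ℕ} (β : Matrix (Fin p) (Fin d) ℝ) :
    Measurable fun x : Fin p → ℝ => βᵀ *ᵥ x :=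
  measurable_reduced β measurable_id

theorem isReductionSubspace_group_iff (hT : Measurable T) {W : Ω → ℝ} (hW : Measurable W)
    (hWT : W ⟂ᵢ[X, hX; μ] T) {s : Fin 2} (hac : μ.map X ≪ (group μ T s).map X)
    (S : Submodule ℝ (Fin p → ℝ)) :
    IsReductionSubspace μ W hX S ↔ IsReductionSubspace (group μ T s) W hX S := by
  refine forall₂_congr fun d β => forall_congr' fun _ => ?_
  have h := condIndepFun_group_iff hT s hX hW hWT hac (f := Prod.snd) measurable_snd
    (k := fun x => βᵀ *ᵥ x.1) ((measurable_transpose_mulVec β).comp measurable_fst)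
  exact ⟨fun h' => (h.1 h'.symm).symm, fun h' => (h.2 h'.symm).symm⟩

/-- If they differed, each subspace would have strictly smaller dimension than the other. -/
theorem IsCentralSubspace.eq_of_isReductionSubspace_iff {𝓦 : Type*} [MeasurableSpace 𝓦]
    {μ' : Measure Ω} [IsFiniteMeasure μ'] {W : Ω → 𝓦}
    (hiff : ∀ S, IsReductionSubspace μ W hX S ↔ IsReductionSubspace μ' W hX S)
    {S S' : Submodule ℝ (Fin p → ℝ)} (h : IsCentralSubspace μ W hX S)
    (h' : IsCentralSubspace μ' W hX S') : S = S' := by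
  by_contra hne
  have h1 := h.2 S' ((hiff S').2 h'.1) (Ne.symm hne)
  have h2 := h'.2 S ((hiff S).1 h.1) hne
  exact lt_asymm h1 h2

theorem condIndepFun_reduced_group_iff (hT : Measurable T) {a b : ℕ}
    (βY : Matrix (Fin p) (Fin a) ℝ) (βT : Matrix (Fin p) (Fin b) ℝ)
    (hTX : T ⟂ᵢ[reduced βT X, measurable_reduced βT hX; μ] X) {s : Fin 2}
    (hac : μ.map X ≪ (group μ T s).map X) (A : Finset (Fin p)) :
    reduced βY X ⟂ᵢ[subvector X A, measurable_subvector hX A; μ] reduced βT X ↔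
      reduced βY X ⟂ᵢ[subvector X A, measurable_subvector hX A; group μ T s] reduced βT X := by
  have hV := measurable_reduced βT hX
  have hacV : μ.map (reduced βT X) ≪ (group μ T s).map (reduced βT X) := by
    have := hac.map (measurable_transpose_mulVec βT)
    rwa [Measure.map_map (measurable_transpose_mulVec βT) hX,
      Measure.map_map (measurable_transpose_mulVec βT) hX] at this
  have h := condIndepFun_group_iff hT s hV hX hTX.symm hacV (f := fun x => βYᵀ *ᵥ x.2)
    ((measurable_transpose_mulVec βY).comp measurable_snd)
    (k := fun x => fun i : {i // i ∈ A} => x.2 i)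
    (measurable_subvector (X := fun x : (Fin b → ℝ) × (Fin p → ℝ) => x.2) measurable_snd A)
  exact ⟨fun h' => (h.1 h'.symm).symm, fun h' => (h.2 h'.symm).symm⟩

/-- Under ignorability and the regularity condition, `A` is a sufficient adjustment set exactly
when the two reduced predictors are conditionally independent given `X_A`. -/
theorem isSufficientAdjustmentSet_iff_condIndepFun_reduced (hT : Measurable T) {W : Ω → ℝ}
    (hW : Measurable W) (hWT : W ⟂ᵢ[X, hX; μ] T) {a b : ℕ}
    (βY : Matrix (Fin p) (Fin a) ℝ) (βT : Matrix (Fin p) (Fin b) ℝ)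
    (hWX : W ⟂ᵢ[reduced βY X, measurable_reduced βY hX; μ] X)
    (hTX : T ⟂ᵢ[reduced βT X, measurable_reduced βT hX; μ] X) (A : Finset (Fin p))
    (hreg : RegularityCondition μ W T hX βY βT A) :
    IsSufficientAdjustmentSet μ W T hX A ↔
      reduced βY X ⟂ᵢ[subvector X A, measurable_subvector hX A; μ] reduced βT X := by
  have hz : Measurable fun x : Fin p → ℝ => fun i : {i // i ∈ A} => x i :=
    measurable_subvector (X := fun x : Fin p → ℝ => x) measurable_id A
  constructor
  · intro hA
    by_contra hdep
    obtain ⟨h, hh, -, hint, hne⟩ := hreg hdep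
    refine hne ?_
    exact condCov_condMean_ae_eq_zero hX (measurable_transpose_mulVec βY)
      (measurable_transpose_mulVec βT) hz hW hT hWT hWX hTX hA hh hint
      (j := fun i : Fin 2 => ((i : ℕ) : ℝ)) (measurable_of_finite _) (C := 1) fun i => by
        fin_cases i <;> simp
  · intro hUV
    exact condIndepFun_of_condIndepFun_reduced hX (measurable_transpose_mulVec βY)
      (measurable_transpose_mulVec βT) hz hW hT hWT hWX hTX hUV

end Groups

theorem dualIdentity_iff_of_colSpace_eq {p k l a b : ℕ} (Sig : Fin 2 → Matrix (Fin p) (Fin p) ℝ)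
    {MY : Matrix (Fin p) (Fin k) ℝ} {MT : Matrix (Fin p) (Fin l) ℝ}
    {βY : Matrix (Fin p) (Fin a) ℝ} {βT : Matrix (Fin p) (Fin b) ℝ}
    (hY : colSpace MY = colSpace βY) (hT : colSpace MT = colSpace βT) (A : Finset (Fin p)) :
    DualIdentity Sig MY MT A ↔ ∀ s, βYᵀ * residualForm (Sig s) A * βT = 0 := by
  rw [dualIdentity_iff_residualForm]
  exact forall_congr' fun s =>
    ⟨transpose_mul_mul_eq_zero_of_colSpace_le hY.ge hT.ge,
      transpose_mul_mul_eq_zero_of_colSpace_le hY.le hT.le⟩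

end CausalAdjustment

end

open CausalAdjustment in
theorem theorem1 {Ω : Type*} [MeasurableSpace Ω] [StandardBorelSpace Ω]
    (μ : Measure Ω) [IsProbabilityMeasure μ] {p : ℕ}
    (X : Ω → Fin p → ℝ) (hX : Measurable X)
    (T : Ω → Fin 2) (hT : Measurable T)
    (Y : Fin 2 → Ω → ℝ) (hY : ∀ s, Measurable (Y s))
    -- ignorability
    (hign : ∀ s, Y s ⟂ᵢ[X, hX; μ] T)
    -- common support
    (hsupp : ((group μ T 1).map X).support = ((group μ T 0).map X).support)
    -- `X | (T = s)` is (nondegenerate) multivariate normal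
    (hnormal : ∀ s, IsGaussian ((group μ T s).map X))
    (hpos : ∀ s, (groupCov μ X T s).PosDef)
    (t : Fin 2) {a b k l : ℕ}
    -- basis matrices of the central subspaces of `Y(t) | X` and `T | X`
    (βY : Matrix (Fin p) (Fin a) ℝ) (βT : Matrix (Fin p) (Fin b) ℝ)
    (hβY : LinearIndependent ℝ βY.col) (hβT : LinearIndependent ℝ βT.col)
    (hSY : IsCentralSubspace μ (Y t) hX (colSpace βY))
    (hST : IsCentralSubspace μ T hX (colSpace βT))
    -- candidate matrices: they span the central subspaces of `Y(t) | (X, T = t)` and `T | X`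
    (MY : Matrix (Fin p) (Fin k) ℝ) (MT : Matrix (Fin p) (Fin l) ℝ)
    (hMY : IsCentralSubspace (group μ T t) (Y t) hX (colSpace MY))
    (hMT : IsCentralSubspace μ T hX (colSpace MT))
    (A : Finset (Fin p))
    -- regularity condition
    (hreg : RegularityCondition μ (Y t) T hX βY βT A) :
    (DualIdentity (groupCov μ X T) MY MT A ↔ IsSufficientAdjustmentSet μ (Y t) T hX A) ∧
    (IsSufficientAdjustmentSet μ (Y t) T hX A ↔ criterion (groupCov μ X T) MY MT A = 0) := by
  have hgauss : ∀ s, HasGaussianLaw X (group μ T s) := fun s =>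
    @IsGaussian.hasGaussianLaw _ _ _ _ _ _ _ _ _ (hnormal s)
  have hequiv := fun s => HasGaussianLaw.map_equivalent_volume hX (hgauss s) (hpos s)
  have hac : ∀ s, μ.map X ≪ (group μ T s).map X := fun s =>
    map_absolutelyContinuous_map_group hX hT fun s' => (hequiv s').1.trans (hequiv s).2
  have hYcol : colSpace MY = colSpace βY :=
    (IsCentralSubspace.eq_of_isReductionSubspace_iff hX
      (isReductionSubspace_group_iff hX hT (hY t) (hign t) (hac t)) hSY hMY).symm
  have hTcol : colSpace MT = colSpace βT :=
    IsCentralSubspace.eq_of_isReductionSubspace_iff hX (fun _ => Iff.rfl) hMT hST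
  have hYX := hSY.1 a βY ⟨hβY, rfl⟩
  have hTX := hST.1 b βT ⟨hβT, rfl⟩
  have hsuff := isSufficientAdjustmentSet_iff_condIndepFun_reduced hX hT (hY t) (hign t) βY βT
    hYX hTX A hreg
  have hgroup : ∀ s, IsSufficientAdjustmentSet μ (Y t) T hX A ↔
      βYᵀ * residualForm (groupCov μ X T s) A * βT = 0 := fun s =>
    (hsuff.trans (condIndepFun_reduced_group_iff hX hT βY βT hTX (hac s) A)).trans
      (HasGaussianLaw.condIndepFun_reduced_iff hX (hgauss s) rfl (hpos s) βY βT A)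
  -- Each group alone characterises sufficiency, so the identity at `s = 0` is enough in one
  -- direction.
  have hdual : DualIdentity (groupCov μ X T) MY MT A ↔ IsSufficientAdjustmentSet μ (Y t) T hX A :=
    (dualIdentity_iff_of_colSpace_eq _ hYcol hTcol A).trans
      ⟨fun h => (hgroup 0).2 (h 0), fun h s => (hgroup s).1 h⟩
  exact ⟨hdual, hdual.symm.trans (criterion_eq_zero_iff hpos MY MT A).symm⟩
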